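/- Let $d,g:\mathbb{N}\to\mathbb{N}$ be two non-decreasing unbounded functions, and let $(H_k)_{k\in\mathbb{N}}$ be a sequence of finite nonempty simple graphs such that, for every $k$, the graph $H_k$ is $d(k)$-regular and has girth at least $g(k)$ (the girth is the length of a shortest cycle, and $\infty$ if there is no cycle). Let $\mathcal{U}$ be a non-principal ultrafilter on $\mathbb{N}$ and let $M=\prod_{\mathcal{U}}H_k$ be the ultraproduct, a structure in the language of graphs. For an internal set $X=[X_k]_{\mathcal{U}}\subseteq M^n$, where $X_k\subseteq H_k^n$, its nonstandard cardinality is $|X|:=[\,|X_k|\,]_{\mathcal{U}}\in\mathbb{R}^{\mathcal{U}}$; in particular this is defined for all definable sets $X$. Put $\alpha=|M|=[\,|H_k|\,]_{\mathcal{U}}$ and $\beta=[d(k)]_{\mathcal{U}}$. Then $|\{x\in M: x\mathrel{R}b\}|=\beta$ for every vertex $b\in M$, where $R$ is the adjacency relation of $M$. Moreover, for every formula $\varphi(\bar x,\bar y)$ in the language of graphs (where $\bar x$ and $\bar y$ are finite tuples of variables) there are finitely many polynomials $p_1,\dots,p_r\in\mathbb{Z}[t_1,t_2]$ and formulas $\psi_1(\bar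 y),\dots,\psi_r(\bar y)$ in the language of graphs such that: 1. the sets $\psi_1(M^{|\bar y|}),\dots,\psi_r(M^{|\bar y|})$ form a partition of $M^{|\bar y|}$ (into nonempty, pairwise disjoint sets); 2. for every $\bar a\in M^{|\bar y|}$ and every $i\in\{1,\dots,r\}$, $$|\varphi(M^{|\bar x|},\bar a)|=p_i(\alpha,\beta)\quad\text{if and only if}\quad M\models\psi_i(\bar a).$$ -/

import Mathlib

open FirstOrder

universe u

/-- The ultraproduct `∏_U H k` of a sequence of graphs: sequences of vertices, two sequences being
identified when they agree on a set of indices that belongs to `U`. -/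
def GraphUltraproduct {V : ℕ → Type u} (U : Ultrafilter ℕ) (_H : ∀ k, SimpleGraph (V k)) : Type u :=
  (U : Filter ℕ).Product V

namespace GraphUltraproduct

variable {V : ℕ → Type u} {U : Ultrafilter ℕ} {H : ∀ k, SimpleGraph (V k)}

/-- The ultraproduct as a structure in the language of graphs. -/
instance instStructure : Language.graph.Structure (GraphUltraproduct U H) :=
  letI : ∀ k, Language.graph.Structure (V k) := fun k => (H k).structure
  inferInstanceAs (Language.graph.Structure ((U : Filter ℕ).Product V))

/-- The element `[f]_U` of the ultraproduct represented by a sequence of vertices `f`. -/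
def mk (f : ∀ k, V k) : GraphUltraproduct U H :=
  (Quotient.mk ((U : Filter ℕ).productSetoid V) f : (U : Filter ℕ).Product V)

theorem mk_eq_mk {f f' : ∀ k, V k} :
    (mk f : GraphUltraproduct U H) = mk f' ↔ ∀ᶠ k in (U : Filter ℕ), f k = f' k :=
  Quotient.eq (r := (U : Filter ℕ).productSetoid V)

/-- The internal set `[S k]_U ⊆ M ^ n` given by a sequence of sets of `n`-tuples: the tuples
`([f 0]_U, …, [f (n - 1)]_U)` such that `(f 0 k, …, f (n - 1) k) ∈ S k` for `U`-almost all `k`. -/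
def internalSet {n : ℕ} (S : ∀ k, Set (Fin n → V k)) : Set (Fin n → GraphUltraproduct U H) :=
  {x | ∃ f : Fin n → ∀ k, V k,
    (∀ i, x i = mk (f i)) ∧ ∀ᶠ k in (U : Filter ℕ), (fun i => f i k) ∈ S k}

/-- `HasCard X c`: the set `X ⊆ M ^ n` is internal, say `X = [S k]_U`, and its nonstandard
cardinality `[|S k|]_U`, an element of the ultrapower of `ℝ` by `U`, is `c`. -/
def HasCard {n : ℕ} (X : Set (Fin n → GraphUltraproduct U H)) (c : (U : Filter ℕ).Germ ℝ) : Prop :=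
  ∃ S : ∀ k, Set (Fin n → V k),
    X = internalSet S ∧ c = ((fun k => ((S k).ncard : ℝ) : ℕ → ℝ) : (U : Filter ℕ).Germ ℝ)

/-- Membership in an internal set can be tested on any representatives. -/
theorem mk_mem_internalSet {n : ℕ} {S : ∀ k, Set (Fin n → V k)} {f : Fin n → ∀ k, V k} :
    (fun i => (mk (f i) : GraphUltraproduct U H)) ∈ internalSet S ↔
      ∀ᶠ k in (U : Filter ℕ), (fun i => f i k) ∈ S k := by
  constructor
  · rintro ⟨f', hf, hS⟩
    have h : ∀ᶠ k in (U : Filter ℕ), ∀ i, f i k = f' i k :=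
      Filter.eventually_all.2 fun i => mk_eq_mk.1 (hf i)
    filter_upwards [h, hS] with k hk hk'
    simpa only [hk] using hk'
  · exact fun h => ⟨f, fun _ => rfl, h⟩

theorem eventually_subset_of_internalSet_subset [∀ k, Nonempty (V k)] {n : ℕ}
    {S T : ∀ k, Set (Fin n → V k)}
    (h : (internalSet S : Set (Fin n → GraphUltraproduct U H)) ⊆ internalSet T) :
    ∀ᶠ k in (U : Filter ℕ), S k ⊆ T k := by
  classical
  by_contra hn
  have hn' : ∀ᶠ k in (U : Filter ℕ), ¬ S k ⊆ T k := Ultrafilter.eventually_not.2 hn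
  have hw : ∀ k, ∃ w : Fin n → V k, ¬ S k ⊆ T k → w ∈ S k ∧ w ∉ T k := by
    intro k
    by_cases hk : S k ⊆ T k
    · exact ⟨fun _ => Classical.arbitrary _, fun h' => absurd hk h'⟩
    · obtain ⟨w, hw⟩ := Set.not_subset.1 hk
      exact ⟨w, fun _ => hw⟩
  choose w hw using hw
  have hS : (fun i => (mk (fun k => w k i) : GraphUltraproduct U H)) ∈ internalSet S :=
    mk_mem_internalSet.2 (hn'.mono fun k hk => (hw k hk).1)
  have hT := mk_mem_internalSet.1 (h hS)
  obtain ⟨k, hk, hk'⟩ := (hn'.and hT).exists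
  exact (hw k hk).2 hk'

/-- The nonstandard cardinality of a set is unique. -/
theorem HasCard.unique [∀ k, Nonempty (V k)] {n : ℕ} {X : Set (Fin n → GraphUltraproduct U H)}
    {c c' : (U : Filter ℕ).Germ ℝ} (h : HasCard X c) (h' : HasCard X c') : c = c' := by
  obtain ⟨S, rfl, rfl⟩ := h
  obtain ⟨T, hT, rfl⟩ := h'
  refine Filter.Germ.coe_eq.2 ?_
  filter_upwards [eventually_subset_of_internalSet_subset hT.subset,
    eventually_subset_of_internalSet_subset hT.symm.subset] with k h1 h2
  rw [h1.antisymm h2]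

end GraphUltraproduct

/-! Below its girth a graph looks like a tree: if `y` is at small positive distance from `a`,
exactly one neighbour of `y` is nearer to `a`, and all others are one step farther. So the distances
from a neighbour of `y` to a tuple depend only on which of the directions from `y` towards the tuple
it takes, and mutual distances decide which directions coincide (`toward_eq_toward_iff`).

Counting is therefore organised by distance types truncated at a finite bound. The core is
`Tame.sum`: summing over one vertex keeps a function polynomial in the order and the degree on each
type. Vertices near a parameter are reached by repeated sums over neighbours (`sum_adj`): finitely
many neighbours are special, and the others all have the same type. Vertices far from every
parameter also share one type, and their number is the order minus a polynomial (`sum_far`).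
Tameness records positivity as well, so an existential quantifier is eliminated as positivity of a
sum of indicators. Hence formulas are local, and their solution counts are polynomial on each type.

Along a non-principal ultrafilter degree and girth exceed every bound, so Łoś's theorem carries this
to `M`. Truncated types are definable and finite in number; grouping them by the value of their
polynomial gives the partition. -/

namespace SimpleGraph

/-! ### Tree-like behaviour of distances below the girth. -/

variable {V : Type u} {G : SimpleGraph V}

/-- The edges of the two paths span a subgraph that is not a forest, since paths in a forest are
unique. A cycle in it repeats no edge, so it has at most as many edges as the two paths together. -/
theorem egirth_le_length_add_length {u v : V} {p q : G.Walk u v} (hp : p.IsPath) (hq : q.IsPath)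
    (hne : p ≠ q) : G.egirth ≤ (p.length + q.length : ℕ) := by
  classical
  set E : Finset (Sym2 V) := (p.edges ++ q.edges).toFinset with hE
  set G' : SimpleGraph V := fromEdgeSet (E : Set (Sym2 V)) with hG'
  have hsub : ∀ e, e ∈ p.edges ∨ e ∈ q.edges → e ∈ G'.edgeSet := by
    intro e he
    rw [hG', edgeSet_fromEdgeSet]
    refine ⟨by simpa [hE] using he, ?_⟩
    have : e ∈ G.edgeSet := he.elim (p.edges_subset_edgeSet ·) (q.edges_subset_edgeSet ·)
    simpa using G.not_isDiag_of_mem_edgeSet this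
  have hle : G' ≤ G := by
    rw [← edgeSet_subset_edgeSet, hG', edgeSet_fromEdgeSet]
    rintro e ⟨he, -⟩
    have he' : e ∈ p.edges ∨ e ∈ q.edges := by simpa [hE] using he
    exact he'.elim (p.edges_subset_edgeSet ·) (q.edges_subset_edgeSet ·)
  have hcyc : ¬ G'.IsAcyclic := by
    intro h
    have := (h.subsingleton_path u v).elim
      ⟨p.transfer G' (fun e he => hsub e (.inl he)), hp.transfer _⟩
      ⟨q.transfer G' (fun e he => hsub e (.inr he)), hq.transfer _⟩
    have h2 := congrArg (fun r : G'.Path u v => r.1.support) this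
    simp only [Walk.support_transfer] at h2
    exact hne (Walk.ext_support h2)
  obtain ⟨w, c, hc⟩ : ∃ w, ∃ c : G'.Walk w w, c.IsCycle := by
    simpa [IsAcyclic] using hcyc
  calc G.egirth ≤ (c.mapLe hle).length := egirth_le_length (hc.mapLe hle)
    _ ≤ _ := by
      norm_cast
      rw [Walk.length_map, ← Walk.length_edges, ← List.toFinset_card_of_nodup hc.isTrail.edges_nodup]
      refine (Finset.card_le_card (t := E) fun e he => ?_).trans ((List.toFinset_card_le _).trans ?_)
      · have := c.edges_subset_edgeSet (List.mem_toFinset.1 he)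
        rw [hG', edgeSet_fromEdgeSet] at this
        exact this.1
      · simp

theorem exists_adj_edist_eq {y a : V} {k : ℕ} (h : G.edist y a = (k + 1 : ℕ)) :
    ∃ x, G.Adj y x ∧ G.edist x a = k := by
  obtain ⟨p, hp⟩ := exists_walk_of_edist_eq_coe h
  cases p with
  | nil => simp at hp
  | @cons _ x _ hadj q =>
    refine ⟨x, hadj, le_antisymm ((edist_le q).trans ?_) ?_⟩
    · simp at hp; simp [hp]
    · have h1 : G.edist y a ≤ G.edist y x + G.edist x a := G.edist_triangle
      rw [h, edist_eq_one_iff_adj.2 hadj, add_comm 1] at h1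
      push_cast at h1
      exact (ENat.add_le_add_iff_right (by simp)).1 h1

theorem edist_le_edist_add_one {x y : V} (hadj : G.Adj y x) (a : V) :
    G.edist x a ≤ G.edist y a + 1 := by
  have h1 : G.edist x a ≤ G.edist x y + G.edist y a := G.edist_triangle
  rwa [edist_eq_one_iff_adj.2 hadj.symm, add_comm] at h1

/-- A shortest path from `x` avoids `y`: otherwise its part after `y` would join `y` to `a` in fewer
than `k` steps. -/
theorem exists_isPath_length_le {y a x : V} {k : ℕ} (hya : G.edist y a = k) (hyx : G.Adj y x)
    (hxa : G.edist x a ≤ k) : ∃ p : G.Walk x a, p.length ≤ k ∧ (Walk.cons hyx p).IsPath := by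
  classical
  have hne : G.edist x a ≠ ⊤ := ne_top_of_le_ne_top (ENat.natCast_ne_top k) hxa
  obtain ⟨p, hp⟩ := exists_walk_of_edist_ne_top hne
  have hpk : p.length ≤ k := by
    rw [← hp] at hxa
    exact_mod_cast hxa
  have hpath : p.IsPath := p.isPath_of_length_eq_dist (by
    rw [dist, ← hp]; rfl)
  refine ⟨p, hpk, (Walk.cons_isPath_iff _ _).2 ⟨hpath, fun hy => ?_⟩⟩
  have h1 : G.edist y a ≤ (p.dropUntil y hy).length := edist_le _
  have h2 : (p.takeUntil y hy).length + (p.dropUntil y hy).length = p.length := by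
    rw [← Walk.length_append, Walk.take_spec]
  have h3 : 0 < (p.takeUntil y hy).length := by
    rw [Nat.pos_iff_ne_zero]
    intro h0
    exact hyx.ne (Walk.eq_of_length_eq_zero h0).symm
  rw [hya] at h1
  have h4 : k ≤ (p.dropUntil y hy).length := by exact_mod_cast h1
  omega

/-- Two such neighbours would give distinct paths from `y` to `a` of length at most `k + 1`, hence a
cycle of length at most `2 * k + 2`. -/
theorem eq_of_adj_of_edist_le {y a x x' : V} {k : ℕ} (hg : ((2 * k + 2 : ℕ) : ℕ∞) < G.egirth)
    (hya : G.edist y a = k) (hyx : G.Adj y x) (hyx' : G.Adj y x')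
    (hxa : G.edist x a ≤ k) (hxa' : G.edist x' a ≤ k) : x = x' := by
  obtain ⟨p, hp, hpp⟩ := exists_isPath_length_le hya hyx hxa
  obtain ⟨q, hq, hqp⟩ := exists_isPath_length_le hya hyx' hxa'
  by_contra hne
  have h := egirth_le_length_add_length hpp hqp (fun h => hne (by
    injection h))
  refine absurd (hg.trans_le h) (not_lt.2 ?_)
  simp only [Walk.length_cons]
  norm_cast
  omega

/-- No neighbour stays at the same distance: the neighbour on a shortest path already is the only
one at distance at most `k`. -/
theorem edist_eq_of_adj {y a x : V} {k : ℕ} (hg : ((2 * k + 2 : ℕ) : ℕ∞) < G.egirth)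
    (hya : G.edist y a = k) (hyx : G.Adj y x) :
    G.edist x a = (k + 1 : ℕ) ∨ ∃ l : ℕ, k = l + 1 ∧ G.edist x a = l := by
  have hle := edist_le_edist_add_one hyx a
  rw [hya] at hle
  rcases hle.lt_or_eq with hlt | heq
  · right
    have hxk : G.edist x a ≤ k := Order.le_of_lt_add_one hlt
    cases k with
    | zero =>
      have h1 : x = a := by simpa using hxk
      have h2 : y = a := by simpa using hya
      exact absurd (h2.trans h1.symm) hyx.ne
    | succ l =>
      obtain ⟨x', hx', hxa'⟩ := exists_adj_edist_eq hya
      have : x = x' := eq_of_adj_of_edist_le hg hya hyx hx' hxk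
        (by rw [hxa']; exact_mod_cast Nat.le_succ l)
      exact ⟨l, rfl, this ▸ hxa'⟩
  · left; rw [heq]; push_cast; rfl

/-- Walks that never turn back are shortest. The step from `u` to `v` leads away from `a`, and the
next vertex towards `w` must again lead away: the only way back is `u`, which is too far from `w`.
-/
theorem edist_eq_add_of_adj (l : ℕ) : ∀ {u v a w : V} {t : ℕ},
    ((2 * (t + l) + 2 : ℕ) : ℕ∞) < G.egirth → G.Adj u v → G.edist u a = t →
    G.edist v a = (t + 1 : ℕ) → G.edist v w = l → G.edist u w = (l + 1 : ℕ) →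
    G.edist w a = (t + 1 + l : ℕ) := by
  induction l with
  | zero =>
    intro u v a w t hg huv hua hva hvw huw
    have : v = w := by simpa using hvw
    rw [← this]; simpa using hva
  | succ l ih =>
    intro u v a w t hg huv hua hva hvw huw
    obtain ⟨v', hvv', hv'w⟩ := exists_adj_edist_eq hvw
    have hg' : ((2 * (t + 1) + 2 : ℕ) : ℕ∞) < G.egirth :=
      lt_of_le_of_lt (by norm_cast; omega) hg
    rcases edist_eq_of_adj hg' hva hvv' with h | ⟨s, hs, h⟩
    · have := ih (t := t + 1) (lt_of_le_of_lt (by norm_cast; omega) hg) hvv' hva h hv'w hvw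
      rw [this]; norm_cast; omega
    · obtain rfl : t = s := by omega
      have : v' = u := eq_of_adj_of_edist_le hg' hva hvv' huv.symm
        (by rw [h]; norm_cast; omega) (by rw [hua]; norm_cast; omega)
      rw [this, huw] at hv'w
      have : l + 1 + 1 = l := by exact_mod_cast hv'w
      omega

/-- If `x` is not nearer to `b`, the shortest paths from `y` to `a` and to `b` part at once, and the
distance from `a` to `b` is the full sum `s + t + 2`. -/
theorem edist_eq_iff_of_adj {x y a b : V} {s t : ℕ}
    (hg : ((2 * (s + t) + 4 : ℕ) : ℕ∞) < G.egirth) (hyx : G.Adj y x)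
    (hya : G.edist y a = (s + 1 : ℕ)) (hxa : G.edist x a = s) (hyb : G.edist y b = (t + 1 : ℕ)) :
    G.edist x b = t ↔ G.edist a b ≤ (s + t + 1 : ℕ) := by
  constructor
  · intro h
    have h1 : G.edist a b ≤ G.edist a x + G.edist x b := G.edist_triangle
    rw [G.edist_comm (u := a) (v := x), hxa, h] at h1
    exact h1.trans (by norm_cast; omega)
  · intro h
    rcases edist_eq_of_adj (lt_of_le_of_lt (by norm_cast; omega) hg) hyb hyx with h' | ⟨l, hl, h'⟩
    · have := edist_eq_add_of_adj s (lt_of_le_of_lt (by norm_cast; omega) hg) hyx hyb h' hxa hya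
      rw [this] at h
      have : t + 1 + 1 + s ≤ s + t + 1 := by exact_mod_cast h
      omega
    · obtain rfl : t = l := by omega
      exact h'

open Classical in
/-- A neighbour of `y` that is one step closer to `a`, if there is one. -/
noncomputable def toward (G : SimpleGraph V) (y a : V) : V :=
  if h : ∃ x, G.Adj y x ∧ G.edist x a + 1 = G.edist y a then h.choose else y

theorem toward_spec {y a : V} {k : ℕ} (h : G.edist y a = (k + 1 : ℕ)) :
    G.Adj y (G.toward y a) ∧ G.edist (G.toward y a) a = k := by
  have hex : ∃ x, G.Adj y x ∧ G.edist x a + 1 = G.edist y a := by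
    obtain ⟨x, hx, hxa⟩ := exists_adj_edist_eq h
    exact ⟨x, hx, by rw [hxa, h]; push_cast; rfl⟩
  rw [toward, dif_pos hex]
  refine ⟨hex.choose_spec.1, ?_⟩
  have := hex.choose_spec.2.trans h
  push_cast at this
  exact ENat.add_right_injective_of_ne_top (n := 1) (by simp) (by simpa [add_comm] using this)

theorem eq_toward_iff {x y a : V} {k : ℕ} (hg : ((2 * k + 4 : ℕ) : ℕ∞) < G.egirth)
    (h : G.edist y a = (k + 1 : ℕ)) (hyx : G.Adj y x) :
    x = G.toward y a ↔ G.edist x a < G.edist y a := by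
  obtain ⟨h1, h2⟩ := toward_spec h
  constructor
  · rintro rfl
    rw [h2, h]; norm_cast; omega
  · intro hlt
    exact eq_of_adj_of_edist_le hg h hyx h1 (h ▸ hlt.le) (by rw [h2]; norm_cast; omega)

theorem toward_eq_toward_iff {y a b : V} {s t : ℕ}
    (hg : ((2 * (s + t) + 4 : ℕ) : ℕ∞) < G.egirth)
    (hya : G.edist y a = (s + 1 : ℕ)) (hyb : G.edist y b = (t + 1 : ℕ)) :
    G.toward y a = G.toward y b ↔ G.edist a b ≤ (s + t + 1 : ℕ) := by
  obtain ⟨h1, h2⟩ := toward_spec hya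
  rw [← edist_eq_iff_of_adj hg h1 hya h2 hyb,
    eq_toward_iff (lt_of_le_of_lt (by norm_cast; omega) hg) hyb h1]
  constructor
  · intro h
    rcases edist_eq_of_adj (lt_of_le_of_lt (by norm_cast; omega) hg) hyb h1 with h' | ⟨l, hl, h'⟩
    · rw [h', hyb] at h
      have : t + 1 + 1 < t + 1 := by exact_mod_cast h
      omega
    · obtain rfl : t = l := by omega
      exact h'
  · intro h
    rw [h, hyb]; norm_cast; omega

end SimpleGraph

/-! ### Regular graphs, truncated distance types, and tame functions. -/

/-- A finite nonempty regular graph. -/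
structure RegGraph : Type (u + 1) where
  V : Type u
  [fintype : Fintype V]
  [nonempty : Nonempty V]
  graph : SimpleGraph V
  deg : ℕ
  ncard_neighborSet : ∀ v, (graph.neighborSet v).ncard = deg

namespace RegGraph

attribute [instance] RegGraph.fintype RegGraph.nonempty

/-- The degree is at least `N` and the girth is larger than `N`. -/
def Large (G : RegGraph.{u}) (N : ℕ) : Prop :=
  N ≤ G.deg ∧ (N : ℕ∞) < G.graph.egirth

theorem Large.mono {G : RegGraph.{u}} {M N : ℕ} (h : G.Large N) (hMN : M ≤ N) : G.Large M :=
  ⟨hMN.trans h.1, lt_of_le_of_lt (by exact_mod_cast hMN) h.2⟩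

/-- The value of a polynomial at the number of vertices and the degree. -/
noncomputable def value (G : RegGraph.{u}) (p : MvPolynomial (Fin 2) ℤ) : ℤ :=
  MvPolynomial.aeval ![(Nat.card G.V : ℤ), (G.deg : ℤ)] p

theorem value_add (G : RegGraph.{u}) (p q : MvPolynomial (Fin 2) ℤ) :
    G.value (p + q) = G.value p + G.value q := map_add _ _ _

theorem value_sub (G : RegGraph.{u}) (p q : MvPolynomial (Fin 2) ℤ) :
    G.value (p - q) = G.value p - G.value q := map_sub _ _ _

theorem value_mul (G : RegGraph.{u}) (p q : MvPolynomial (Fin 2) ℤ) :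
    G.value (p * q) = G.value p * G.value q := map_mul _ _ _

theorem value_sum (G : RegGraph.{u}) {ι : Type*} (s : Finset ι)
    (p : ι → MvPolynomial (Fin 2) ℤ) : G.value (∑ i ∈ s, p i) = ∑ i ∈ s, G.value (p i) :=
  map_sum _ _ _

theorem value_natCast (G : RegGraph.{u}) (n : ℕ) : G.value n = n := map_natCast _ _

theorem value_X_zero (G : RegGraph.{u}) : G.value (MvPolynomial.X 0) = Nat.card G.V := by
  simp [value]

theorem value_X_one (G : RegGraph.{u}) : G.value (MvPolynomial.X 1) = G.deg := by
  simp [value]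

end RegGraph

variable {ι κ : Type} {G G₀ G' : RegGraph.{u}} {N M : ℕ}

/-- Two tuples have the same mutual distances, up to distance `N`. -/
def Sim (N : ℕ) (a : ι → G.V) (a' : ι → G'.V) : Prop :=
  ∀ i j, ∀ k : ℕ, k ≤ N → (G.graph.edist (a i) (a j) ≤ k ↔ G'.graph.edist (a' i) (a' j) ≤ k)

namespace Sim

theorem refl (a : ι → G.V) : Sim N a a := fun _ _ _ _ => Iff.rfl

theorem symm {a : ι → G.V} {a' : ι → G'.V} (h : Sim N a a') : Sim N a' a :=
  fun i j k hk => (h i j k hk).symm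

theorem mono {a : ι → G.V} {a' : ι → G'.V} (h : Sim N a a') (hMN : M ≤ N) : Sim M a a' :=
  fun i j k hk => h i j k (hk.trans hMN)

theorem comp {a : ι → G.V} {a' : ι → G'.V} (h : Sim N a a') (e : κ → ι) :
    Sim N (a ∘ e) (a' ∘ e) :=
  fun i j k hk => h (e i) (e j) k hk

theorem edist_eq {a : ι → G.V} {a' : ι → G'.V} (h : Sim N a a') {i j : ι} {t : ℕ} (ht : t ≤ N)
    (hij : G.graph.edist (a i) (a j) = t) : G'.graph.edist (a' i) (a' j) = t := by
  have h1 : G'.graph.edist (a' i) (a' j) ≤ t := (h i j t ht).1 hij.le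
  refine le_antisymm h1 ?_
  lift G'.graph.edist (a' i) (a' j) to ℕ using ne_top_of_le_ne_top (by simp) h1 with s hs
  have := (h i j s ((by exact_mod_cast h1 : s ≤ t).trans ht)).2 hs.symm.le
  rwa [hij] at this

end Sim

/-- The tuple `a` extended by the element `x`. -/
def consOpt {α : Type*} (x : α) (a : ι → α) : Option ι → α := fun o => o.elim x a

@[simp] theorem consOpt_none {α : Type*} (x : α) (a : ι → α) : consOpt x a none = x := rfl

@[simp] theorem consOpt_some {α : Type*} (x : α) (a : ι → α) (i : ι) :
    consOpt x a (some i) = a i := rfl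

theorem Sim.cons {a : ι → G.V} {a' : ι → G'.V} (h : Sim N a a') {x : G.V} {x' : G'.V}
    (hx : ∀ i, ∀ k : ℕ, k ≤ N →
      (G.graph.edist x (a i) ≤ k ↔ G'.graph.edist x' (a' i) ≤ k)) :
    Sim N (consOpt x a) (consOpt x' a') := by
  rintro (_ | i) (_ | j) k hk
  · simp
  · exact hx j k hk
  · rw [G.graph.edist_comm, G'.graph.edist_comm]; exact hx i k hk
  · exact h i j k hk

open Classical in
/-- The indicator of a proposition. -/
noncomputable def ind (p : Prop) : ℕ := if p then 1 else 0

theorem ind_of {p : Prop} (h : p) : ind p = 1 := if_pos h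

theorem ind_of_not {p : Prop} (h : ¬ p) : ind p = 0 := if_neg h

@[simp] theorem ind_pos_iff {p : Prop} : 0 < ind p ↔ p := by
  unfold ind; split_ifs <;> simp_all

theorem ind_mul_add_ind_not_mul (p : Prop) (n : ℕ) : ind p * n + ind (¬ p) * n = n := by
  unfold ind; split_ifs <;> simp_all

/-- A property of tuples of vertices that is, in regular graphs of large degree and large girth,
determined by the mutual distances up to some bound. -/
def LocalPred (P : ∀ G : RegGraph.{u}, (ι → G.V) → Prop) : Prop :=
  ∃ N, ∀ (G G' : RegGraph.{u}) (a : ι → G.V) (a' : ι → G'.V), G.Large N → G'.Large N →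
    Sim N a a' → P G a → P G' a'

/-- A numerical function of tuples of vertices that is, in regular graphs of large degree and large
girth, a polynomial in the number of vertices and the degree once the mutual distances up to some
bound are fixed, and whose vanishing is determined by these distances. -/
def Tame (f : ∀ G : RegGraph.{u}, (ι → G.V) → ℕ) : Prop :=
  ∃ N, ∀ (G₀ : RegGraph.{u}) (a₀ : ι → G₀.V), G₀.Large N → ∃ p : MvPolynomial (Fin 2) ℤ,
    ∀ (G : RegGraph.{u}) (a : ι → G.V), G.Large N → Sim N a₀ a →
      (f G a : ℤ) = G.value p ∧ (0 < f G₀ a₀ ↔ 0 < f G a)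

namespace LocalPred

variable {P Q : ∀ G : RegGraph.{u}, (ι → G.V) → Prop}

theorem not (hP : LocalPred P) : LocalPred fun G a => ¬ P G a := by
  obtain ⟨N, hN⟩ := hP
  exact ⟨N, fun G G' a a' hG hG' h hn hP => hn (hN G' G a' a hG' hG h.symm hP)⟩

theorem and (hP : LocalPred P) (hQ : LocalPred Q) : LocalPred fun G a => P G a ∧ Q G a := by
  obtain ⟨N, hN⟩ := hP
  obtain ⟨M, hM⟩ := hQ
  exact ⟨max N M, fun G G' a a' hG hG' h hPQ =>
    ⟨hN G G' a a' (hG.mono (le_max_left _ _)) (hG'.mono (le_max_left _ _))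
      (h.mono (le_max_left _ _)) hPQ.1,
    hM G G' a a' (hG.mono (le_max_right _ _)) (hG'.mono (le_max_right _ _))
      (h.mono (le_max_right _ _)) hPQ.2⟩⟩

theorem congr (hP : LocalPred P) (h : ∀ G a, P G a ↔ Q G a) : LocalPred Q := by
  have : P = Q := by
    funext G a
    exact propext (h G a)
  exact this ▸ hP

theorem imp (hP : LocalPred P) (hQ : LocalPred Q) : LocalPred fun G a => P G a → Q G a :=
  (hP.and hQ.not).not.congr fun G a => by tauto

theorem comp (hP : LocalPred P) (e : ι → κ) : LocalPred fun G (a : κ → G.V) => P G (a ∘ e) := by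
  obtain ⟨N, hN⟩ := hP
  exact ⟨N, fun G G' a a' hG hG' h => hN G G' _ _ hG hG' (h.comp e)⟩

theorem edist_le (i j : ι) (k : ℕ) :
    LocalPred.{u} fun G (a : ι → G.V) => G.graph.edist (a i) (a j) ≤ k :=
  ⟨k, fun _ _ _ _ _ _ h => (h i j k le_rfl).1⟩

theorem edist_eq (i j : ι) (k : ℕ) :
    LocalPred.{u} fun G (a : ι → G.V) => G.graph.edist (a i) (a j) = k :=
  ⟨k, fun _ _ _ _ _ _ h => h.edist_eq le_rfl⟩

theorem tame (hP : LocalPred P) : Tame fun G a => ind (P G a) := by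
  obtain ⟨N, hN⟩ := hP
  refine ⟨N, fun G₀ a₀ hG₀ => ⟨(ind (P G₀ a₀) : ℕ), fun G a hG h => ?_⟩⟩
  have : P G₀ a₀ ↔ P G a := ⟨hN _ _ _ _ hG₀ hG h, hN _ _ _ _ hG hG₀ h.symm⟩
  rw [RegGraph.value_natCast]
  simp [this]

end LocalPred

namespace Tame

variable {f g : ∀ G : RegGraph.{u}, (ι → G.V) → ℕ}

theorem localPred_pos (hf : Tame f) : LocalPred fun G a => 0 < f G a := by
  obtain ⟨N, hN⟩ := hf
  refine ⟨N, fun G G' a a' hG hG' h => ?_⟩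
  obtain ⟨p, hp⟩ := hN G a hG
  exact (hp G' a' hG' h).2.1

theorem congr (hf : Tame f) (N : ℕ)
    (h : ∀ G : RegGraph.{u}, G.Large N → ∀ a, f G a = g G a) : Tame g := by
  obtain ⟨M, hM⟩ := hf
  refine ⟨max N M, fun G₀ a₀ hG₀ => ?_⟩
  obtain ⟨p, hp⟩ := hM G₀ a₀ (hG₀.mono (le_max_right _ _))
  refine ⟨p, fun G a hG hs => ?_⟩
  rw [← h G (hG.mono (le_max_left _ _)), ← h G₀ (hG₀.mono (le_max_left _ _))]
  exact hp G a (hG.mono (le_max_right _ _)) (hs.mono (le_max_right _ _))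

theorem add (hf : Tame f) (hg : Tame g) : Tame fun G a => f G a + g G a := by
  obtain ⟨N, hN⟩ := hf
  obtain ⟨M, hM⟩ := hg
  refine ⟨max N M, fun G₀ a₀ hG₀ => ?_⟩
  obtain ⟨p, hp⟩ := hN G₀ a₀ (hG₀.mono (le_max_left _ _))
  obtain ⟨q, hq⟩ := hM G₀ a₀ (hG₀.mono (le_max_right _ _))
  refine ⟨p + q, fun G a hG hs => ?_⟩
  obtain ⟨h1, h2⟩ := hp G a (hG.mono (le_max_left _ _)) (hs.mono (le_max_left _ _))
  obtain ⟨h3, h4⟩ := hq G a (hG.mono (le_max_right _ _)) (hs.mono (le_max_right _ _))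
  rw [RegGraph.value_add, ← h1, ← h3, add_pos_iff, add_pos_iff, h2, h4]
  exact ⟨by push_cast; rfl, Iff.rfl⟩

theorem mul (hf : Tame f) (hg : Tame g) : Tame fun G a => f G a * g G a := by
  obtain ⟨N, hN⟩ := hf
  obtain ⟨M, hM⟩ := hg
  refine ⟨max N M, fun G₀ a₀ hG₀ => ?_⟩
  obtain ⟨p, hp⟩ := hN G₀ a₀ (hG₀.mono (le_max_left _ _))
  obtain ⟨q, hq⟩ := hM G₀ a₀ (hG₀.mono (le_max_right _ _))
  refine ⟨p * q, fun G a hG hs => ?_⟩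
  obtain ⟨h1, h2⟩ := hp G a (hG.mono (le_max_left _ _)) (hs.mono (le_max_left _ _))
  obtain ⟨h3, h4⟩ := hq G a (hG.mono (le_max_right _ _)) (hs.mono (le_max_right _ _))
  rw [RegGraph.value_mul, ← h1, ← h3, CanonicallyOrderedAdd.mul_pos,
    CanonicallyOrderedAdd.mul_pos, h2, h4]
  exact ⟨by push_cast; rfl, Iff.rfl⟩

theorem zero : Tame fun (G : RegGraph.{u}) (_ : ι → G.V) => 0 :=
  ⟨0, fun _ _ _ => ⟨0, fun _ _ _ _ => ⟨by simp [RegGraph.value], Iff.rfl⟩⟩⟩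

theorem finset_sum {σ : Type*} (s : Finset σ) {F : σ → ∀ G : RegGraph.{u}, (ι → G.V) → ℕ}
    (hF : ∀ i, Tame (F i)) : Tame fun G a => ∑ i ∈ s, F i G a := by
  classical
  induction s using Finset.induction_on with
  | empty => simpa using zero
  | insert i s hi ih =>
    simp only [Finset.sum_insert hi]
    exact (hF i).add ih

theorem comp (hf : Tame f) (e : ι → κ) : Tame fun G (a : κ → G.V) => f G (a ∘ e) := by
  obtain ⟨N, hN⟩ := hf
  refine ⟨N, fun G₀ a₀ hG₀ => ?_⟩
  obtain ⟨p, hp⟩ := hN G₀ (a₀ ∘ e) hG₀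
  exact ⟨p, fun G a hG hs => hp G (a ∘ e) hG (hs.comp e)⟩

theorem ind_mul {P : ∀ G : RegGraph.{u}, (ι → G.V) → Prop} (hP : LocalPred P) (hf : Tame f) :
    Tame fun G a => ind (P G a) * f G a :=
  hP.tame.mul hf

end Tame

/-- A step to a neighbour changes each relevant distance by exactly one, so only the sign of the
change has to match. Entries farther than `N + 1` remain farther than `N`. -/
theorem Sim.cons_of_adj {b₀ : ι → G₀.V} {b : ι → G.V} (hM : 2 * N + 4 ≤ M) (hG₀ : G₀.Large M)
    (hG : G.Large M) (h : Sim M b₀ b) {j : ι} {x₀ : G₀.V} {x : G.V}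
    (hx₀ : G₀.graph.Adj (b₀ j) x₀) (hx : G.graph.Adj (b j) x)
    (hlt : ∀ i, ∀ t ≤ N, G₀.graph.edist (b₀ j) (b₀ i) = (t + 1 : ℕ) →
      (G₀.graph.edist x₀ (b₀ i) < G₀.graph.edist (b₀ j) (b₀ i) ↔
        G.graph.edist x (b i) < G.graph.edist (b j) (b i))) :
    Sim N (consOpt x₀ b₀) (consOpt x b) := by
  refine (h.mono (by omega)).cons fun i k hk => ?_
  by_cases hfar : G₀.graph.edist (b₀ j) (b₀ i) ≤ (N + 1 : ℕ)
  · obtain ⟨t, ht⟩ := ENat.ne_top_iff_exists.1 (ne_top_of_le_ne_top (by simp) hfar)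
    replace ht := ht.symm
    have htN : t ≤ N + 1 := by rw [ht] at hfar; exact_mod_cast hfar
    have ht' := h.edist_eq (by omega) ht
    have hg₀ : ((2 * t + 2 : ℕ) : ℕ∞) < G₀.graph.egirth :=
      lt_of_le_of_lt (by norm_cast; omega) hG₀.2
    have hg : ((2 * t + 2 : ℕ) : ℕ∞) < G.graph.egirth :=
      lt_of_le_of_lt (by norm_cast; omega) hG.2
    rcases SimpleGraph.edist_eq_of_adj hg₀ ht hx₀ with h1 | ⟨l, hl, h1⟩ <;>
    rcases SimpleGraph.edist_eq_of_adj hg ht' hx with h2 | ⟨l', hl', h2⟩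
    · rw [h1, h2]
    · subst hl'
      have := (hlt i l' (by omega) ht).2 (by rw [h2, ht']; norm_cast; omega)
      rw [h1, ht] at this
      have : l' + 1 + 1 < l' + 1 := by exact_mod_cast this
      omega
    · subst hl
      have := (hlt i l (by omega) ht).1 (by rw [h1, ht]; norm_cast; omega)
      rw [h2, ht'] at this
      have : l + 1 + 1 < l + 1 := by exact_mod_cast this
      omega
    · obtain rfl : l = l' := by omega
      rw [h1, h2]
  · have hfar' : ¬ G.graph.edist (b j) (b i) ≤ (N + 1 : ℕ) := fun hh =>
      hfar ((h j i (N + 1) (by omega)).2 hh)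
    have key : ∀ {G : RegGraph.{u}} {y x a : G.V}, ¬ G.graph.edist y a ≤ (N + 1 : ℕ) →
        G.graph.Adj y x → ¬ G.graph.edist x a ≤ k := by
      intro G y x a hfar hyx hle
      refine hfar ((SimpleGraph.edist_le_edist_add_one hyx.symm a).trans ?_)
      push_cast
      gcongr
      exact hle.trans (by exact_mod_cast hk)
    exact iff_of_false (key hfar hx₀) (key hfar' hx)

open Classical in
theorem sum_ind_mul {V : Type*} [Fintype V] (P : V → Prop) (f : V → ℕ) :
    ∑ x, ind (P x) * f x = ∑ x with P x, f x := by
  rw [Finset.sum_filter]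
  exact Finset.sum_congr rfl fun x _ => by unfold ind; split_ifs <;> simp

open Classical in
theorem RegGraph.card_filter_adj (G : RegGraph.{u}) (y : G.V) :
    (Finset.univ.filter fun x => G.graph.Adj y x).card = G.deg := by
  rw [← G.ncard_neighborSet y, ← Set.ncard_coe_finset]
  congr 1
  ext x
  simp

/-! ### Summation over vertices near the parameters. -/

namespace Tame

/-- The sum of a tame function over the neighbours of a vertex is tame. -/
theorem sum_adj [Finite ι] {f : ∀ G : RegGraph.{u}, (Option ι → G.V) → ℕ} (hf : Tame f) (j : ι) :
    Tame fun G b => ∑ x, ind (G.graph.Adj (b j) x) * f G (consOpt x b) := by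
  classical
  have := Fintype.ofFinite ι
  obtain ⟨N, hN⟩ := hf
  -- The girth must exceed `2 * (s + t) + 4` for `s, t ≤ N`; the summand `Fintype.card ι` makes the
  -- degree exceed the number of directions.
  set M := 4 * N + 8 + Fintype.card ι with hMdef
  refine ⟨M, fun G₀ b₀ hG₀ => ?_⟩
  choose P hP using fun x₀ => hN G₀ (consOpt x₀ b₀) (hG₀.mono (by omega))
  -- Only entries at distance from `1` to `N + 1` define a direction that affects the type up to
  -- `N`. The subset `I'` keeps one index for each distinct direction.
  set I : Finset ι := Finset.univ.filter fun i =>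
    ∃ t ≤ N, G₀.graph.edist (b₀ j) (b₀ i) = (t + 1 : ℕ) with hI
  set n₀ : ι → G₀.V := fun i => G₀.graph.toward (b₀ j) (b₀ i) with hn₀
  obtain ⟨I', hI'I, himg, hinj⟩ : ∃ I' ⊆ I, I'.image n₀ = I.image n₀ ∧ Set.InjOn n₀ I' := by
    obtain ⟨u, hu, hui, hinj⟩ := Finset.exists_subset_injOn_image_eq_of_surjOn
      (f := n₀) (I : Set ι) (I.image n₀) (by intro x hx; simpa using hx)
    exact ⟨u, by exact_mod_cast hu, hinj, hui⟩
  have hI'card : I'.card ≤ Fintype.card ι := Finset.card_le_univ _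
  obtain ⟨x₀, hx₀, hx₀I⟩ : ∃ x₀, G₀.graph.Adj (b₀ j) x₀ ∧ x₀ ∉ I'.image n₀ := by
    by_contra! hcon
    have h1 : (Finset.univ.filter fun x => G₀.graph.Adj (b₀ j) x) ⊆ I'.image n₀ := by
      intro x hx
      exact hcon x (by simpa using hx)
    have h2 := (Finset.card_le_card h1).trans Finset.card_image_le
    rw [G₀.card_filter_adj] at h2
    have := hG₀.1
    omega
  -- In every similar tuple the directions coincide in the same pattern, so `I'` represents them
  -- there too. The remaining `G.deg - I'.card` neighbours all extend the tuple to the type given by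
  -- `x₀`.
  have key : ∀ (G : RegGraph.{u}) (b : ι → G.V), G.Large M → Sim M b₀ b →
      ∃ x : G.V, ∃ n : ι → G.V, Sim N (consOpt x₀ b₀) (consOpt x b) ∧
        (∀ i ∈ I', Sim N (consOpt (n₀ i) b₀) (consOpt (n i) b)) ∧
        ∑ x, ind (G.graph.Adj (b j) x) * f G (consOpt x b) =
          (G.deg - I'.card) * f G (consOpt x b) + ∑ i ∈ I', f G (consOpt (n i) b) := by
    intro G b hG hs
    set n : ι → G.V := fun i => G.graph.toward (b j) (b i) with hn
    have hIdist : ∀ i ∈ I, ∃ t ≤ N, G₀.graph.edist (b₀ j) (b₀ i) = (t + 1 : ℕ) ∧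
        G.graph.edist (b j) (b i) = (t + 1 : ℕ) := by
      intro i hi
      obtain ⟨t, ht, h⟩ := (Finset.mem_filter.1 hi).2
      exact ⟨t, ht, h, hs.edist_eq (by omega) h⟩
    have hgirth : ∀ {G : RegGraph.{u}}, G.Large M → ∀ {s t : ℕ}, s ≤ N → t ≤ N →
        ((2 * (s + t) + 4 : ℕ) : ℕ∞) < G.graph.egirth := fun hG s t hs ht =>
      lt_of_le_of_lt (by norm_cast; omega) hG.2
    have hneq : ∀ i ∈ I, ∀ l ∈ I, n₀ i = n₀ l ↔ n i = n l := by
      intro i hi l hl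
      obtain ⟨s, hsN, h1, h2⟩ := hIdist i hi
      obtain ⟨t, htN, h3, h4⟩ := hIdist l hl
      rw [hn₀, hn, SimpleGraph.toward_eq_toward_iff (hgirth hG₀ hsN htN) h1 h3,
        SimpleGraph.toward_eq_toward_iff (hgirth hG hsN htN) h2 h4]
      exact hs i l _ (by omega)
    have hnimg : ∀ i ∈ I, ∃ l ∈ I', n₀ l = n₀ i ∧ n l = n i := by
      intro i hi
      obtain ⟨l, hl, hli⟩ := Finset.mem_image.1 (himg ▸ Finset.mem_image_of_mem n₀ hi)
      exact ⟨l, hl, hli, (hneq l (hI'I hl) i hi).1 hli⟩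
    have hsim : ∀ z₀ z, G₀.graph.Adj (b₀ j) z₀ → G.graph.Adj (b j) z →
        (∀ i ∈ I, z₀ = n₀ i ↔ z = n i) → Sim N (consOpt z₀ b₀) (consOpt z b) := by
      intro z₀ z hz₀ hz hiff
      refine hs.cons_of_adj (by omega) hG₀ hG hz₀ hz fun i t ht h => ?_
      have hi : i ∈ I := Finset.mem_filter.2 ⟨Finset.mem_univ _, t, ht, h⟩
      have h' := hs.edist_eq (by omega) h
      rw [← SimpleGraph.eq_toward_iff (hgirth hG₀ (s := 0) (by omega) ht |>.trans_eq' (by simp)) h hz₀,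
        ← SimpleGraph.eq_toward_iff (hgirth hG (s := 0) (by omega) ht |>.trans_eq' (by simp)) h' hz]
      exact hiff i hi
    have hfree : ∀ z, G.graph.Adj (b j) z → z ∉ I'.image n →
        Sim N (consOpt x₀ b₀) (consOpt z b) := by
      intro z hz hzI
      refine hsim x₀ z hx₀ hz fun i hi => ?_
      obtain ⟨l, hl, h1, h2⟩ := hnimg i hi
      refine iff_of_false ?_ ?_
      · rintro rfl
        exact hx₀I (Finset.mem_image.2 ⟨l, hl, h1⟩)
      · rintro rfl
        exact hzI (Finset.mem_image.2 ⟨l, hl, h2⟩)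
    have hinjn : Set.InjOn n I' := fun i hi l hl h =>
      hinj hi hl ((hneq i (hI'I hi) l (hI'I hl)).2 h)
    have hsub : I'.image n ⊆ Finset.univ.filter fun x => G.graph.Adj (b j) x := by
      intro x hx
      obtain ⟨i, hi, rfl⟩ := Finset.mem_image.1 hx
      obtain ⟨t, -, -, h⟩ := hIdist i (hI'I hi)
      simpa using (SimpleGraph.toward_spec h).1
    have hcard : ((Finset.univ.filter fun x => G.graph.Adj (b j) x) \ I'.image n).card =
        G.deg - I'.card := by
      rw [Finset.card_sdiff_of_subset hsub, Finset.card_image_of_injOn hinjn, G.card_filter_adj]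
    obtain ⟨x, hx⟩ : ((Finset.univ.filter fun x => G.graph.Adj (b j) x) \ I'.image n).Nonempty := by
      rw [← Finset.card_pos, hcard]
      have := hG.1
      omega
    rw [Finset.mem_sdiff, Finset.mem_filter] at hx
    refine ⟨x, n, hfree x hx.1.2 hx.2, fun i hi => ?_, ?_⟩
    · obtain ⟨t, -, h, h'⟩ := hIdist i (hI'I hi)
      exact hsim _ _ (SimpleGraph.toward_spec h).1 (SimpleGraph.toward_spec h').1
        fun l hl => hneq i (hI'I hi) l hl
    · rw [sum_ind_mul, ← Finset.sum_sdiff hsub, Finset.sum_image hinjn, ← hcard, ← smul_eq_mul,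
        ← Finset.sum_const]
      congr 1
      refine Finset.sum_congr rfl fun z hz => ?_
      rw [Finset.mem_sdiff, Finset.mem_filter] at hz
      have h1 := (hP x₀ G _ (hG.mono (by omega)) (hfree z hz.1.2 hz.2)).1
      have h2 := (hP x₀ G _ (hG.mono (by omega)) (hfree x hx.1.2 hx.2)).1
      exact_mod_cast h1.trans h2.symm
  refine ⟨(MvPolynomial.X 1 - (I'.card : MvPolynomial (Fin 2) ℤ)) * P x₀ + ∑ i ∈ I', P (n₀ i),
    fun G b hG hs => ?_⟩
  have hpos : ∀ (G : RegGraph.{u}) (b : ι → G.V), G.Large M → Sim M b₀ b →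
      (0 < ∑ x, ind (G.graph.Adj (b j) x) * f G (consOpt x b) ↔
        0 < f G₀ (consOpt x₀ b₀) ∨ ∃ i ∈ I', 0 < f G₀ (consOpt (n₀ i) b₀)) := by
    intro G b hG hs
    obtain ⟨x, n, hx, hn, hsum⟩ := key G b hG hs
    have hdeg : 0 < G.deg - I'.card := by have := hG.1; omega
    rw [hsum, add_pos_iff, CanonicallyOrderedAdd.mul_pos,
      ← (hP x₀ G _ (hG.mono (by omega)) hx).2, Finset.sum_pos_iff]
    refine or_congr (by simp [hdeg]) (exists_congr fun i => and_congr_right fun hi => ?_)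
    exact (hP _ G _ (hG.mono (by omega)) (hn i hi)).2.symm
  refine ⟨?_, (hpos G₀ b₀ hG₀ (Sim.refl _)).trans (hpos G b hG hs).symm⟩
  obtain ⟨x, n, hx, hn, hsum⟩ := key G b hG hs
  have hdeg : I'.card ≤ G.deg := by have := hG.1; omega
  beta_reduce
  rw [hsum, RegGraph.value_add, RegGraph.value_mul, RegGraph.value_sub, RegGraph.value_X_one,
    RegGraph.value_natCast, RegGraph.value_sum, ← (hP x₀ G _ (hG.mono (by omega)) hx).1]
  push_cast [Nat.cast_sub hdeg]
  congr 1
  exact Finset.sum_congr rfl fun i hi => (hP _ G _ (hG.mono (by omega)) (hn i hi)).1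

/-- The sum of a tame function over the vertices at a given distance is tame. -/
theorem sum_edist_eq [Finite ι] (i : ι) (k : ℕ) :
    ∀ {f : ∀ G : RegGraph.{u}, (Option ι → G.V) → ℕ}, Tame f →
      Tame fun G a => ∑ x, ind (G.graph.edist x (a i) = k) * f G (consOpt x a) := by
  induction k with
  | zero =>
    intro f hf
    refine (hf.comp fun o : Option ι => o.getD i).congr 0 fun G _ a => ?_
    rw [Finset.sum_eq_single (a i)]
    · rw [ind_of (by simp), one_mul]
      congr 1
      funext o
      cases o <;> rfl
    · intro x _ hx
      rw [ind_of_not (by simpa using hx), zero_mul]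
    · simp
  | succ k ih =>
    intro f hf
    -- In `c` the entry `none` is `x` and `some none` is an intermediate vertex `y`. Each `x` at
    -- distance `k + 1` has exactly one neighbour `y` at distance `k`, so summing over `y` and then
    -- over its neighbours counts each `x` once.
    have hg : Tame fun G (c : Option (Option ι) → G.V) =>
        ind (G.graph.edist (c none) (c (some (some i))) = (k + 1 : ℕ)) *
          f G (c ∘ fun o => o.elim none fun l => some (some l)) :=
      ind_mul (.edist_eq none (some (some i)) (k + 1)) (hf.comp _)
    refine (ih (hg.sum_adj none)).congr (2 * (k + 1) + 2) fun G hG a => ?_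
    have hcomp : ∀ x y, (consOpt x (consOpt y a) ∘
        fun o : Option ι => o.elim none fun l => some (some l)) = consOpt x a := by
      intro x y
      funext o
      cases o <;> rfl
    simp only [consOpt_none, consOpt_some, hcomp, Finset.mul_sum]
    rw [Finset.sum_comm]
    refine Finset.sum_congr rfl fun x _ => ?_
    by_cases hx : G.graph.edist x (a i) = (k + 1 : ℕ)
    · obtain ⟨y, hxy, hya⟩ := SimpleGraph.exists_adj_edist_eq hx
      rw [Finset.sum_eq_single y]
      · rw [ind_of hya, ind_of hxy.symm, one_mul, one_mul]
      · intro z _ hz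
        by_cases hzx : G.graph.Adj z x
        · rw [ind_of_not (p := G.graph.edist z (a i) = k), zero_mul]
          intro hza
          exact hz (SimpleGraph.eq_of_adj_of_edist_le hG.2 hx hzx.symm hxy
            (by rw [hza]; norm_cast; omega) (by rw [hya]; norm_cast; omega))
        · rw [ind_of_not hzx, zero_mul, mul_zero]
      · simp
    · simp only [ind_of_not hx, zero_mul, mul_zero, Finset.sum_const_zero]

theorem sum_edist_le [Finite ι] (i : ι) (R : ℕ)
    {f : ∀ G : RegGraph.{u}, (Option ι → G.V) → ℕ} (hf : Tame f) :
    Tame fun G a => ∑ x, ind (G.graph.edist x (a i) ≤ R) * f G (consOpt x a) := by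
  refine (finset_sum (Finset.range (R + 1)) fun k => hf.sum_edist_eq i k).congr 0
    fun G _ a => ?_
  rw [Finset.sum_comm]
  refine Finset.sum_congr rfl fun x _ => ?_
  by_cases hx : G.graph.edist x (a i) ≤ R
  · obtain ⟨t, ht⟩ := ENat.ne_top_iff_exists.1 (ne_top_of_le_ne_top (by simp) hx)
    rw [← ht] at hx ⊢
    have htR : t ≤ R := by exact_mod_cast hx
    rw [ind_of hx, Finset.sum_eq_single t]
    · rw [ind_of rfl]
    · intro k _ hk
      rw [ind_of_not (by exact_mod_cast hk.symm), zero_mul]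
    · intro h
      exact absurd (Finset.mem_range.2 (by omega)) h
  · rw [ind_of_not hx, zero_mul]
    refine Finset.sum_eq_zero fun k hk => ?_
    rw [ind_of_not, zero_mul]
    intro h
    rw [h] at hx
    have := Finset.mem_range.1 hk
    exact hx (by norm_cast; omega)

/-- The balls may overlap: after the ball around `a i` is summed, the indicator of its complement is
absorbed into `f`, which is why `f` varies in the induction. -/
theorem sum_exists_edist_le [Finite ι] (R : ℕ) (s : Finset ι) :
    ∀ {f : ∀ G : RegGraph.{u}, (Option ι → G.V) → ℕ}, Tame f →
      Tame fun G a => ∑ x, ind (∃ i ∈ s, G.graph.edist x (a i) ≤ R) * f G (consOpt x a) := by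
  classical
  induction s using Finset.induction_on with
  | empty =>
    intro f hf
    exact zero.congr 0 fun G _ a => by simp [ind_of_not]
  | insert i s hi ih =>
    intro f hf
    have hg : Tame fun G (c : Option ι → G.V) =>
        ind (¬ G.graph.edist (c none) (c (some i)) ≤ R) * f G c :=
      ind_mul (LocalPred.edist_le none (some i) R).not hf
    refine ((hf.sum_edist_le i R).add (ih hg)).congr 0 fun G _ a => ?_
    rw [← Finset.sum_add_distrib]
    refine Finset.sum_congr rfl fun x _ => ?_
    simp only [consOpt_none, consOpt_some, Finset.exists_mem_insert]
    by_cases h1 : G.graph.edist x (a i) ≤ R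
    · rw [ind_of h1, ind_of_not (not_not.2 h1), ind_of (Or.inl h1), zero_mul, mul_zero, add_zero]
    · rw [ind_of_not h1, ind_of h1]
      simp [h1]

end Tame

/-! ### Vertices far from the parameters. -/

/-- In a regular graph of large degree and girth, some vertex is far from given ones. -/
theorem RegGraph.Large.exists_lt_edist [Finite ι] {R : ℕ}
    (hG : G.Large (2 * R + 4 + Nat.card ι)) (a : ι → G.V) :
    ∃ x, ∀ i, ¬ G.graph.edist x (a i) ≤ R := by
  classical
  have := Fintype.ofFinite ι
  rw [Nat.card_eq_fintype_card] at hG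
  -- Walk away from all the entries at once: a neighbour in none of the at most `Fintype.card ι`
  -- directions increases every distance up to `R + 1` by one.
  suffices h : ∀ s ≤ R + 1, ∃ x, ∀ i, (s : ℕ∞) ≤ G.graph.edist x (a i) by
    obtain ⟨x, hx⟩ := h (R + 1) le_rfl
    refine ⟨x, fun i hi => ?_⟩
    have : R + 1 ≤ R := by exact_mod_cast (hx i).trans hi
    omega
  intro s
  induction s with
  | zero => exact fun _ => ⟨Classical.arbitrary _, fun i => by simp⟩
  | succ s ih =>
    intro hs
    obtain ⟨y, hy⟩ := ih (by omega)
    obtain ⟨x, hyx, hxI⟩ : ∃ x, G.graph.Adj y x ∧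
        x ∉ Finset.univ.image fun i => G.graph.toward y (a i) := by
      by_contra! hcon
      have h1 : (Finset.univ.filter fun x => G.graph.Adj y x) ⊆
          Finset.univ.image fun i => G.graph.toward y (a i) := by
        intro x hx
        exact hcon x (by simpa using hx)
      have h2 := (Finset.card_le_card h1).trans Finset.card_image_le
      rw [G.card_filter_adj, Finset.card_univ] at h2
      have := hG.1
      omega
    refine ⟨x, fun i => ?_⟩
    by_cases hyi : G.graph.edist y (a i) ≤ (R + 1 : ℕ)
    · obtain ⟨t, ht⟩ := ENat.ne_top_iff_exists.1 (ne_top_of_le_ne_top (by simp) hyi)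
      have htR : t ≤ R + 1 := by rw [← ht] at hyi; exact_mod_cast hyi
      have hst : s ≤ t := by have := hy i; rw [← ht] at this; exact_mod_cast this
      rcases SimpleGraph.edist_eq_of_adj (lt_of_le_of_lt (by norm_cast; omega) hG.2) ht.symm hyx
        with h | ⟨l, rfl, h⟩
      · rw [h]; norm_cast; omega
      · refine absurd (Finset.mem_image.2 ⟨i, Finset.mem_univ _, Eq.symm ?_⟩) hxI
        rw [SimpleGraph.eq_toward_iff (lt_of_le_of_lt (by norm_cast; omega) hG.2) ht.symm hyx, h,
          ← ht]
        norm_cast; omega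
    · by_contra hlt
      refine hyi ((SimpleGraph.edist_le_edist_add_one hyx.symm (a i)).trans ?_)
      push_cast
      gcongr
      have h1 : G.graph.edist x (a i) < (s : ℕ∞) + 1 := by exact_mod_cast not_le.1 hlt
      exact (Order.le_of_lt_add_one h1).trans (by norm_cast; omega)

namespace Tame

/-- All vertices beyond `R` extend the tuple to one type, so `f` has a single value there, and their
number is the order minus the count of near vertices. Hypothesis `hR` is tameness of `f` with its
bound exposed, since this bound serves as the radius. -/
theorem sum_far [Finite ι] (R : ℕ) {f : ∀ G : RegGraph.{u}, (Option ι → G.V) → ℕ}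
    (hR : ∀ (G₀ : RegGraph.{u}) (a₀ : Option ι → G₀.V), G₀.Large R →
      ∃ p : MvPolynomial (Fin 2) ℤ, ∀ (G : RegGraph.{u}) (a : Option ι → G.V), G.Large R →
        Sim R a₀ a → (f G a : ℤ) = G.value p ∧ (0 < f G₀ a₀ ↔ 0 < f G a)) :
    Tame fun G a => ∑ x, ind (¬ ∃ i, G.graph.edist x (a i) ≤ R) * f G (consOpt x a) := by
  classical
  have := Fintype.ofFinite ι
  have hone : Tame fun (G : RegGraph.{u}) (_ : Option ι → G.V) => ind True :=
    LocalPred.tame ⟨0, fun _ _ _ _ _ _ _ h => h⟩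
  obtain ⟨N, hN⟩ := hone.sum_exists_edist_le R Finset.univ
  set M := N + 2 * R + 4 + Nat.card ι with hM
  refine ⟨M, fun G₀ a₀ hG₀ => ?_⟩
  obtain ⟨q, hq⟩ := hN G₀ a₀ (hG₀.mono (by omega))
  obtain ⟨x₀, hx₀⟩ := RegGraph.Large.exists_lt_edist (R := R) (hG₀.mono (by omega)) a₀
  obtain ⟨p, hp⟩ := hR G₀ (consOpt x₀ a₀) (hG₀.mono (by omega))
  have hsim : ∀ (G : RegGraph.{u}) (a : ι → G.V) x, Sim M a₀ a →
      (¬ ∃ i, G.graph.edist x (a i) ≤ R) → Sim R (consOpt x₀ a₀) (consOpt x a) := by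
    intro G a x hs hx
    refine (hs.mono (by omega)).cons fun i k hk => ?_
    have hk' : (k : ℕ∞) ≤ R := by exact_mod_cast hk
    exact iff_of_false (fun h => hx₀ i (h.trans hk')) fun h => hx ⟨i, h.trans hk'⟩
  have hpos : ∀ (G : RegGraph.{u}) (a : ι → G.V), G.Large M → Sim M a₀ a →
      (0 < ∑ x, ind (¬ ∃ i, G.graph.edist x (a i) ≤ R) * f G (consOpt x a) ↔
        0 < f G₀ (consOpt x₀ a₀)) := by
    intro G a hG hs
    rw [Finset.sum_pos_iff]
    constructor
    · rintro ⟨x, -, hx⟩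
      rw [CanonicallyOrderedAdd.mul_pos, ind_pos_iff] at hx
      exact (hp G _ (hG.mono (by omega)) (hsim G a x hs hx.1)).2.2 hx.2
    · intro h
      obtain ⟨x, hx⟩ := RegGraph.Large.exists_lt_edist (R := R) (hG.mono (by omega)) a
      have hx' : ¬ ∃ i, G.graph.edist x (a i) ≤ R := fun ⟨i, hi⟩ => hx i hi
      refine ⟨x, Finset.mem_univ _, ?_⟩
      rw [CanonicallyOrderedAdd.mul_pos, ind_pos_iff]
      exact ⟨hx', (hp G _ (hG.mono (by omega)) (hsim G a x hs hx')).2.1 h⟩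
  refine ⟨(MvPolynomial.X 0 - q) * p, fun G a hG hs =>
    ⟨?_, (hpos G₀ a₀ hG₀ (Sim.refl _)).trans (hpos G a hG hs).symm⟩⟩
  have hnear := (hq G a (hG.mono (by omega)) (hs.mono (by omega))).1
  have hcount : (∑ x : G.V, ind (¬ ∃ i, G.graph.edist x (a i) ≤ R)) +
      ∑ x : G.V, ind (∃ i ∈ Finset.univ, G.graph.edist x (a i) ≤ R) * ind True = Nat.card G.V := by
    rw [← Finset.sum_add_distrib, Nat.card_eq_fintype_card, ← Finset.card_univ,
      Finset.card_eq_sum_ones]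
    refine Finset.sum_congr rfl fun x _ => ?_
    have := ind_mul_add_ind_not_mul (∃ i, G.graph.edist x (a i) ≤ R) 1
    simp only [Finset.mem_univ, true_and, ind_of trivial]
    omega
  rw [RegGraph.value_mul, RegGraph.value_sub, RegGraph.value_X_zero, ← hnear, ← hcount]
  push_cast
  rw [add_sub_cancel_right, Finset.sum_mul]
  refine Finset.sum_congr rfl fun x _ => ?_
  by_cases hx : ∃ i, G.graph.edist x (a i) ≤ R
  · rw [ind_of_not (not_not.2 hx)]; simp
  · rw [(hp G _ (hG.mono (by omega)) (hsim G a x hs hx)).1]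

/-- Summation over one variable preserves tameness. -/
theorem sum [Finite ι] {f : ∀ G : RegGraph.{u}, (Option ι → G.V) → ℕ} (hf : Tame f) :
    Tame fun G a => ∑ x, f G (consOpt x a) := by
  have := Fintype.ofFinite ι
  obtain ⟨R, hR⟩ := id hf
  refine ((hf.sum_exists_edist_le R Finset.univ).add (sum_far R hR)).congr 0 fun G _ a => ?_
  rw [← Finset.sum_add_distrib]
  refine Finset.sum_congr rfl fun x _ => ?_
  simpa using ind_mul_add_ind_not_mul (∃ i, G.graph.edist x (a i) ≤ R) (f G (consOpt x a))

end Tame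

/-! ### Quantifier elimination by counting, and solution counts. -/

open FirstOrder.Language

/-- A regular graph as a structure in the language of graphs. -/
instance RegGraph.instStructure (G : RegGraph.{u}) : Language.graph.Structure G.V :=
  G.graph.structure

theorem FirstOrder.Language.graph.exists_term_eq_var {α : Type*} (t : Language.graph.Term α) :
    ∃ i, t = Term.var i := by
  cases t with
  | var i => exact ⟨i, rfl⟩
  | func f _ => exact isEmptyElim f

/-- A witness exists exactly when the sum of the indicators is positive, and tameness makes
positivity local. -/
theorem LocalPred.exists_vertex [Finite ι] {P : ∀ G : RegGraph.{u}, (Option ι → G.V) → Prop}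
    (hP : LocalPred P) : LocalPred fun G a => ∃ x, P G (consOpt x a) := by
  refine hP.tame.sum.localPred_pos.congr fun G a => ?_
  rw [Finset.sum_pos_iff]
  simp

/-- In regular graphs of large degree and girth, the truth of a formula is determined by the
distances up to some bound. -/
theorem FirstOrder.Language.BoundedFormula.localPred {α : Type} [Finite α] {n : ℕ}
    (φ : Language.graph.BoundedFormula α n) :
    LocalPred fun (G : RegGraph.{u}) (a : α ⊕ Fin n → G.V) =>
      φ.Realize (a ∘ Sum.inl) (a ∘ Sum.inr) := by
  induction φ with
  | falsum => exact ⟨0, fun _ _ _ _ _ _ _ h => h⟩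
  | equal t₁ t₂ =>
    obtain ⟨i, rfl⟩ := graph.exists_term_eq_var t₁
    obtain ⟨j, rfl⟩ := graph.exists_term_eq_var t₂
    refine (LocalPred.edist_eq i j 0).congr fun G a => ?_
    simp only [BoundedFormula.Realize, Term.realize_var, Sum.elim_comp_inl_inr, Nat.cast_zero,
      SimpleGraph.edist_eq_zero_iff]
  | rel R ts =>
    cases R
    obtain ⟨i, hi⟩ := graph.exists_term_eq_var (ts 0)
    obtain ⟨j, hj⟩ := graph.exists_term_eq_var (ts 1)
    refine (LocalPred.edist_eq i j 1).congr fun G a => ?_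
    simp only [BoundedFormula.Realize, Sum.elim_comp_inl_inr, Nat.cast_one,
      SimpleGraph.edist_eq_one_iff_adj]
    change _ ↔ G.graph.Adj ((ts 0).realize a) ((ts 1).realize a)
    rw [hi, hj, Term.realize_var, Term.realize_var]
  | imp _ _ ih₁ ih₂ => exact ih₁.imp ih₂
  | @all n φ ih =>
    -- The quantified variable is the last one and becomes `none`; the universal quantifier is then
    -- treated as `¬ ∃ ¬`.
    let e : α ⊕ Fin (n + 1) → Option (α ⊕ Fin n) :=
      Sum.elim (fun i => some (.inl i)) (Fin.snoc (fun j => some (.inr j)) none)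
    refine (ih.comp e).not.exists_vertex.not.congr fun G a => ?_
    simp only [not_exists, not_not, BoundedFormula.Realize]
    refine forall_congr' fun x => ?_
    have h : (consOpt x a ∘ e) ∘ Sum.inr = Fin.snoc (a ∘ Sum.inr) x := by
      funext j
      refine Fin.lastCases ?_ (fun j => ?_) j <;> simp [e]
    rw [h]
    rfl

theorem FirstOrder.Language.Formula.localPred {α : Type} [Finite α]
    (φ : Language.graph.Formula α) :
    LocalPred fun (G : RegGraph.{u}) (a : α → G.V) => φ.Realize a := by
  refine ((BoundedFormula.localPred φ).comp (Sum.elim id Fin.elim0)).congr fun G a => ?_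
  rw [Formula.Realize, Subsingleton.elim (default : Fin 0 → G.V)]
  rfl

namespace Tame

theorem sum_tuple (n : ℕ) : ∀ {ι : Type} [Finite ι]
    {f : ∀ G : RegGraph.{u}, (Fin n ⊕ ι → G.V) → ℕ}, Tame f →
      Tame fun G a => ∑ x : Fin n → G.V, f G (Sum.elim x a) := by
  induction n with
  | zero =>
    intro ι _ f hf
    refine (hf.comp (Sum.elim Fin.elim0 id)).congr 0 fun G _ a => ?_
    rw [Fintype.sum_unique]
    congr 1
    funext o
    rcases o with j | i
    · exact j.elim0
    · rfl
  | succ n ih =>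
    intro ι _ f hf
    let e : Fin (n + 1) ⊕ ι → Fin n ⊕ Option ι :=
      Sum.elim (Fin.cons (.inr none) .inl) fun i => .inr (some i)
    refine (ih (hf.comp e)).sum.congr 0 fun G _ a => ?_
    rw [← (Fin.consEquiv fun _ : Fin (n + 1) => G.V).sum_comp, Fintype.sum_prod_type]
    refine Finset.sum_congr rfl fun x _ => Finset.sum_congr rfl fun y _ => ?_
    congr 1
    funext o
    rcases o with j | i
    · refine Fin.cases ?_ (fun j => ?_) j <;> simp [e, Fin.consEquiv]
    · rfl

/-- The distances between the members of a tuple, up to `N`. -/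
def _root_.distType (N : ℕ) (a : ι → G.V) : ι → ι → Fin (N + 1) → Prop :=
  fun i j k => G.graph.edist (a i) (a j) ≤ (k : ℕ)

theorem _root_.Sim.of_distType_eq {a : ι → G.V} {a' : ι → G'.V}
    (h : distType N a = distType N a') : Sim N a a' := fun i j k hk =>
  iff_of_eq (congrFun (congrFun (congrFun h i) j) ⟨k, by omega⟩)

theorem exists_polynomial {f : ∀ G : RegGraph.{u}, (ι → G.V) → ℕ} (hf : Tame f) :
    ∃ N, ∃ p : (ι → ι → Fin (N + 1) → Prop) → MvPolynomial (Fin 2) ℤ,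
      ∀ (G : RegGraph.{u}) (a : ι → G.V), G.Large N → (f G a : ℤ) = G.value (p (distType N a)) := by
  obtain ⟨N, hN⟩ := hf
  have : ∀ τ : ι → ι → Fin (N + 1) → Prop, ∃ p : MvPolynomial (Fin 2) ℤ,
      ∀ (G : RegGraph.{u}) (a : ι → G.V), G.Large N → distType N a = τ →
        (f G a : ℤ) = G.value p := by
    intro τ
    by_cases h : ∃ (G₀ : RegGraph.{u}) (a₀ : ι → G₀.V), G₀.Large N ∧ distType N a₀ = τ
    · obtain ⟨G₀, a₀, hG₀, rfl⟩ := h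
      obtain ⟨p, hp⟩ := hN G₀ a₀ hG₀
      exact ⟨p, fun G a hG h => (hp G a hG (Sim.of_distType_eq h.symm)).1⟩
    -- No large graph realises this type, so any polynomial would do.
    · exact ⟨0, fun G a hG ha => absurd ⟨G, a, hG, ha⟩ h⟩
  choose p hp using this
  exact ⟨N, p, fun G a hG => hp _ G a hG rfl⟩

end Tame

/-- The number of solutions of a formula is a polynomial in the number of vertices and the degree
that depends only on the distances between the parameters up to some bound. -/
theorem exists_polynomial_ncard_realize {n m : ℕ} (φ : Language.graph.Formula (Fin n ⊕ Fin m)) :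
    ∃ N, ∃ p : (Fin m → Fin m → Fin (N + 1) → Prop) → MvPolynomial (Fin 2) ℤ,
      ∀ (G : RegGraph.{u}) (a : Fin m → G.V), G.Large N →
        ({x : Fin n → G.V | φ.Realize (Sum.elim x a)}.ncard : ℤ) = G.value (p (distType N a)) := by
  classical
  obtain ⟨N, p, hp⟩ := (Tame.sum_tuple n φ.localPred.tame).exists_polynomial
  refine ⟨N, p, fun G a hG => ?_⟩
  rw [← hp G a hG, Set.ncard_eq_toFinset_card', Set.toFinset_ofPred, Finset.card_filter]
  push_cast
  exact Finset.sum_congr rfl fun x _ => by unfold ind; split_ifs <;> rfl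

/-! ### Definability of bounded distances and transfer to the ultraproduct. -/

theorem SimpleGraph.edist_le_succ_iff {V : Type*} {G : SimpleGraph V} {x y : V} {k : ℕ} :
    G.edist x y ≤ (k + 1 : ℕ) ↔ ∃ z, (x = z ∨ G.Adj x z) ∧ G.edist z y ≤ k := by
  constructor
  · intro h
    rcases h.lt_or_eq with h | h
    · exact ⟨x, .inl rfl, Order.le_of_lt_add_one (by exact_mod_cast h)⟩
    · obtain ⟨z, hz, hzy⟩ := exists_adj_edist_eq h
      exact ⟨z, .inr hz, hzy.le⟩
  · rintro ⟨z, rfl | hz, hzy⟩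
    · exact hzy.trans (by norm_cast; omega)
    · refine (edist_le_edist_add_one hz.symm y).trans ?_
      push_cast
      gcongr

/-- The formula expressing that two vertices are at distance at most `k`. -/
noncomputable def distFormula : ℕ → Language.graph.Formula (Fin 2)
  | 0 => Term.equal (Term.var 0) (Term.var 1)
  | k + 1 => Formula.iExs (Fin 1)
      (((Term.equal (Term.var (.inl 0)) (Term.var (.inr 0))) ⊔
        Language.adj.formula₂ (Term.var (.inl 0)) (Term.var (.inr 0))) ⊓
        (distFormula k).relabel ![.inr 0, .inl 1])

theorem realize_distFormula {V : Type*} (G : SimpleGraph V) (k : ℕ) (v : Fin 2 → V) :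
    letI := G.structure
    (distFormula k).Realize v ↔ G.edist (v 0) (v 1) ≤ k := by
  let := G.structure
  induction k generalizing v with
  | zero => simp [distFormula]
  | succ k ih =>
    rw [SimpleGraph.edist_le_succ_iff, distFormula, Formula.realize_iExs]
    simp only [Formula.realize_inf, Formula.realize_sup, Formula.realize_equal, Term.realize_var,
      Formula.realize_rel₂, Formula.realize_relabel, ih, Sum.elim_inl, Sum.elim_inr]
    constructor
    · rintro ⟨z, h1, h2⟩
      exact ⟨z 0, h1, h2⟩
    · rintro ⟨z, h1, h2⟩
      exact ⟨fun _ => z, h1, h2⟩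

namespace GraphUltraproduct

variable {V : ℕ → Type u} {U : Ultrafilter ℕ} {H : ∀ k, SimpleGraph (V k)}

theorem exists_eq_mk {ι : Type*} (a : ι → GraphUltraproduct U H) :
    ∃ f : ι → ∀ k, V k, a = fun i => mk (f i) := by
  choose f hf using fun i => Quotient.exists_rep (s := (U : Filter ℕ).productSetoid V) (a i)
  exact ⟨f, funext fun i => (hf i).symm⟩

theorem realize_mk [∀ k, Nonempty (V k)] {ι : Type*} (φ : Language.graph.Formula ι)
    (f : ι → ∀ k, V k) :
    (φ.Realize fun i => (mk (f i) : GraphUltraproduct U H)) ↔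
      ∀ᶠ k in (U : Filter ℕ), letI := (H k).structure; φ.Realize fun i => f i k := by
  let : ∀ k, Language.graph.Structure (V k) := fun k => (H k).structure
  exact Ultraproduct.realize_formula_cast (u := U) φ f

/-- The solution set of a formula is internal. -/
theorem setOf_realize_eq_internalSet [∀ k, Nonempty (V k)] {n : ℕ} {ι : Type*}
    (φ : Language.graph.Formula (Fin n ⊕ ι)) (f : ι → ∀ k, V k) :
    {x : Fin n → GraphUltraproduct U H | φ.Realize (Sum.elim x fun i => mk (f i))} =
      internalSet fun k => letI := (H k).structure; {x | φ.Realize (Sum.elim x fun i => f i k)} := by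
  ext x
  obtain ⟨h, rfl⟩ := exists_eq_mk x
  rw [mk_mem_internalSet, Set.mem_ofPred_eq]
  have h1 : (Sum.elim (fun i => mk (h i)) fun i => mk (f i) : Fin n ⊕ ι → GraphUltraproduct U H) =
      fun o => mk (Sum.elim h f o) := by
    funext o; cases o <;> rfl
  rw [h1, realize_mk]
  refine Filter.eventually_congr (.of_forall fun k => ?_)
  have h2 : (fun o => Sum.elim h f o k) = Sum.elim (fun i => h i k) fun i => f i k := by
    funext o; cases o <;> rfl
  rw [h2]
  rfl

theorem realize_adj_iff {x y : GraphUltraproduct U H} [∀ k, Nonempty (V k)] :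
    Language.Structure.RelMap Language.adj ![x, y] ↔
      (Language.adj.formula₂ (Term.var (.inl 0)) (Term.var (.inr 0)) :
        Language.graph.Formula (Fin 1 ⊕ Fin 1)).Realize (Sum.elim (fun _ => x) fun _ => y) := by
  rw [Formula.realize_rel₂]; rfl

end GraphUltraproduct

/-- Both passing to germs and evaluating at an index are ring homomorphisms, so they commute with
polynomial evaluation. -/
theorem Filter.Germ.aeval_coe {α σ : Type*} (l : Filter α) (f : σ → α → ℝ) (p : MvPolynomial σ ℤ) :
    MvPolynomial.aeval (fun i => ((f i : α → ℝ) : l.Germ ℝ)) p =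
      ((fun k => MvPolynomial.aeval (fun i => f i k) p : α → ℝ) : l.Germ ℝ) := by
  let F : (α → ℝ) →ₐ[ℤ] l.Germ ℝ :=
    { Filter.Germ.coeRingHom l with commutes' := fun n => by simp [Filter.Germ.coeRingHom] }
  have h1 := MvPolynomial.comp_aeval_apply f F p
  have h2 : (MvPolynomial.aeval f p : α → ℝ) = fun k => MvPolynomial.aeval (fun i => f i k) p := by
    funext k
    exact MvPolynomial.comp_aeval_apply f (Pi.evalAlgHom ℤ (fun _ => ℝ) k) p
  rw [← h2]
  exact h1.symm

/-- The formula expressing that a tuple has a given type of distances up to `N`. -/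
theorem exists_formula_of_distType {m N : ℕ} (τ : Fin m → Fin m → Fin (N + 1) → Prop) :
    ∃ ψ : Language.graph.Formula (Fin m), ∀ {M : Type u} [Language.graph.Structure M]
      (a : Fin m → M), ψ.Realize a ↔
        ∀ i j k, ((distFormula (k : Fin (N + 1))).relabel ![i, j]).Realize a ↔ τ i j k := by
  classical
  refine ⟨Formula.iInf fun t : Fin m × Fin m × Fin (N + 1) =>
    if τ t.1 t.2.1 t.2.2 then (distFormula t.2.2).relabel ![t.1, t.2.1]
    else ((distFormula t.2.2).relabel ![t.1, t.2.1]).not, fun a => ?_⟩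
  rw [Formula.realize_iInf, Prod.forall]
  refine forall_congr' fun i => ?_
  rw [Prod.forall]
  refine forall₂_congr fun j k => ?_
  dsimp only
  split_ifs with h
  · exact (iff_true_right h).symm
  · rw [Formula.realize_not]
    exact (iff_false_right h).symm

/-! ### Assembly of the theorem. -/

theorem mainTheorem4 {V : ℕ → Type u} [∀ k, Finite (V k)] [∀ k, Nonempty (V k)]
    (d g : ℕ → ℕ)
    (hd_mono : Monotone d) (hd_unbdd : ¬ BddAbove (Set.range d))
    (hg_mono : Monotone g) (hg_unbdd : ¬ BddAbove (Set.range g))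
    (H : ∀ k, SimpleGraph (V k)) [∀ k, (H k).LocallyFinite]
    (hreg : ∀ k, (H k).IsRegularOfDegree (d k))
    (hgirth : ∀ k, (g k : ℕ∞) ≤ (H k).egirth)
    (U : Ultrafilter ℕ) (hU : ∀ k, U ≠ pure k)
    (α β : (U : Filter ℕ).Germ ℝ)
    (hα : α = ((fun k => (Nat.card (V k) : ℝ) : ℕ → ℝ) : (U : Filter ℕ).Germ ℝ))
    (hβ : β = ((fun k => (d k : ℝ) : ℕ → ℝ) : (U : Filter ℕ).Germ ℝ)) :
    -- `α` is the nonstandard size of `M`, and `β` that of the neighbourhood of any vertex of `M`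
    GraphUltraproduct.HasCard (Set.univ : Set (Fin 1 → GraphUltraproduct U H)) α ∧
    (∀ b : GraphUltraproduct U H,
      GraphUltraproduct.HasCard
        {x : Fin 1 → GraphUltraproduct U H |
          Language.Structure.RelMap Language.adj ![x 0, b]} β) ∧
    ∀ (n m : ℕ) (φ : Language.graph.Formula (Fin n ⊕ Fin m)),
      ∃ (r : ℕ) (p : Fin r → MvPolynomial (Fin 2) ℤ) (ψ : Fin r → Language.graph.Formula (Fin m)),
        -- the sets `ψ i (M ^ m)` are nonempty and every tuple lies in exactly one of them
        (∀ i, ∃ a : Fin m → GraphUltraproduct U H, (ψ i).Realize a) ∧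
        (∀ a : Fin m → GraphUltraproduct U H, ∃! i, (ψ i).Realize a) ∧
        ∀ (a : Fin m → GraphUltraproduct U H) (i : Fin r),
          GraphUltraproduct.HasCard
              {x : Fin n → GraphUltraproduct U H | φ.Realize (Sum.elim x a)}
              (MvPolynomial.aeval ![α, β] (p i)) ↔
            (ψ i).Realize a := by
  classical
  let : ∀ k, Language.graph.Structure (V k) := fun k => (H k).structure
  have hncard : ∀ k v, ((H k).neighborSet v).ncard = d k := fun k v => by
    rw [← hreg k v, ← SimpleGraph.card_neighborSet_eq_degree, Set.ncard_eq_toFinset_card',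
      Set.toFinset_card]
  refine ⟨⟨fun _ => Set.univ, ?_, ?_⟩, fun b => ?_, fun n m φ => ?_⟩
  · ext x
    obtain ⟨f, rfl⟩ := GraphUltraproduct.exists_eq_mk x
    simp [GraphUltraproduct.mk_mem_internalSet]
  · rw [hα]
    congr 1
    funext k
    rw [Set.ncard_univ, Nat.card_fun]
    simp
  · obtain ⟨f, hf⟩ := GraphUltraproduct.exists_eq_mk fun _ : Fin 1 => b
    have hset : {x : Fin 1 → GraphUltraproduct U H |
        Language.Structure.RelMap Language.adj ![x 0, b]} =
        {x | (Language.adj.formula₂ (Term.var (.inl 0)) (Term.var (.inr 0)) :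
          Language.graph.Formula (Fin 1 ⊕ Fin 1)).Realize
            (Sum.elim x fun i => GraphUltraproduct.mk (f i))} := by
      ext x
      rw [Set.mem_ofPred_eq, Set.mem_ofPred_eq, GraphUltraproduct.realize_adj_iff, hf]
      have : (fun _ => x 0) = x := funext fun i => by rw [Subsingleton.elim i 0]
      rw [this]
    refine ⟨_, hset.trans (GraphUltraproduct.setOf_realize_eq_internalSet _ f), ?_⟩
    rw [hβ]
    congr 1
    funext k
    rw [← hncard k (f 0 k)]
    congr 1
    refine Set.ncard_congr (fun v _ _ => v) (fun v hv => ?_) (fun v w _ _ h => ?_) fun x hx => ?_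
    · have := hv.symm
      simp only [Set.mem_ofPred_eq]
      rw [Formula.realize_rel₂]
      exact this
    · exact congrFun h 0
    · simp only [Set.mem_ofPred_eq] at hx
      rw [Formula.realize_rel₂] at hx
      exact ⟨x 0, SimpleGraph.Adj.symm hx, funext fun i => by rw [Subsingleton.elim i 0]⟩
  · have := fun k => Fintype.ofFinite (V k)
    let G : ℕ → RegGraph.{u} := fun k => ⟨V k, H k, d k, hncard k⟩
    -- A non-principal ultrafilter contains all cofinite sets, so `d` and `g` pass every bound for
    -- almost all indices.
    have hUtop : (U : Filter ℕ) ≤ Filter.atTop := by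
      rw [← Nat.cofinite_eq_atTop]
      exact U.le_cofinite_or_eq_pure.resolve_right fun ⟨k, hk⟩ => hU k hk
    have hlarge : ∀ N, ∀ᶠ k in (U : Filter ℕ), (G k).Large N := by
      intro N
      refine Filter.Eventually.filter_mono hUtop ?_
      filter_upwards [(Filter.tendsto_atTop_atTop_of_monotone' hd_mono hd_unbdd).eventually_ge_atTop N,
        (Filter.tendsto_atTop_atTop_of_monotone' hg_mono hg_unbdd).eventually_gt_atTop N]
        with k h1 h2
      exact ⟨h1, lt_of_lt_of_le (by exact_mod_cast h2) (hgirth k)⟩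
    obtain ⟨N, p, hp⟩ := exists_polynomial_ncard_realize.{u} φ
    let t : (Fin m → GraphUltraproduct U H) → Fin m → Fin m → Fin (N + 1) → Prop :=
      fun a i j k => ((distFormula k).relabel ![i, j]).Realize a
    let val : (Fin m → Fin m → Fin (N + 1) → Prop) → (U : Filter ℕ).Germ ℝ :=
      fun τ => MvPolynomial.aeval ![α, β] (p τ)
    have hcard : ∀ a : Fin m → GraphUltraproduct U H, GraphUltraproduct.HasCard
        {x : Fin n → GraphUltraproduct U H | φ.Realize (Sum.elim x a)} (val (t a)) := by
      intro a
      obtain ⟨f, rfl⟩ := GraphUltraproduct.exists_eq_mk a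
      refine ⟨_, GraphUltraproduct.setOf_realize_eq_internalSet φ f, ?_⟩
      have hval : val (t fun i => GraphUltraproduct.mk (f i)) =
          ((fun k => MvPolynomial.aeval ![(Nat.card (V k) : ℝ), (d k : ℝ)]
            (p (t fun i => GraphUltraproduct.mk (f i))) : ℕ → ℝ) : (U : Filter ℕ).Germ ℝ) := by
        have h := Filter.Germ.aeval_coe (U : Filter ℕ)
          ![fun k => (Nat.card (V k) : ℝ), fun k => (d k : ℝ)]
          (p (t fun i => GraphUltraproduct.mk (f i)))
        have e1 : (fun i => ((![fun k => (Nat.card (V k) : ℝ), fun k => (d k : ℝ)] i : ℕ → ℝ) :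
            (U : Filter ℕ).Germ ℝ)) = ![α, β] := by
          funext i; fin_cases i <;> simp [hα, hβ]
        have e2 : ∀ k, (fun i => (![fun k => (Nat.card (V k) : ℝ), fun k => (d k : ℝ)] :
            Fin 2 → ℕ → ℝ) i k) = ![(Nat.card (V k) : ℝ), (d k : ℝ)] := by
          intro k
          funext i; fin_cases i <;> rfl
        simp only [e1, e2] at h
        exact h
      rw [hval]
      refine Filter.Germ.coe_eq.2 ?_
      -- By Łoś's theorem, applied to finitely many distance formulas, the type of the tuple in `M`
      -- is its type in almost every `H k`.
      have htype : ∀ᶠ k in (U : Filter ℕ), distType (G := G k) N (fun i => f i k) =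
          t fun i => GraphUltraproduct.mk (f i) := by
        have h : ∀ᶠ k in (U : Filter ℕ), ∀ i j l, distType (G := G k) N (fun i => f i k) i j l ↔
            t (fun i => GraphUltraproduct.mk (f i)) i j l := by
          refine Filter.eventually_all.2 fun i => Filter.eventually_all.2 fun j =>
            Filter.eventually_all.2 fun l => ?_
          have h1 : t (fun i => GraphUltraproduct.mk (f i)) i j l ↔
              ∀ᶠ k in (U : Filter ℕ), distType (G := G k) N (fun i => f i k) i j l := by
            refine (GraphUltraproduct.realize_mk _ f).trans ?_
            refine Filter.eventually_congr (.of_forall fun k => ?_)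
            rw [Formula.realize_relabel]
            exact realize_distFormula (H k) l _
          by_cases ht : t (fun i => GraphUltraproduct.mk (f i)) i j l
          · exact (h1.1 ht).mono fun k hk => iff_of_true hk ht
          · exact (Ultrafilter.eventually_not.2 fun h => ht (h1.2 h)).mono
              fun k hk => iff_of_false hk ht
        filter_upwards [h] with k hk
        funext i j l
        exact propext (hk i j l)
      filter_upwards [htype, hlarge N] with k hk hL
      have h := hp (G k) (fun i => f i k) hL
      rw [hk] at h
      have h' := congrArg (Int.cast : ℤ → ℝ) h
      have e : (((G k).value (p (t fun i => GraphUltraproduct.mk (f i))) : ℤ) : ℝ) =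
          MvPolynomial.aeval ![(Nat.card (V k) : ℝ), (d k : ℝ)]
            (p (t fun i => GraphUltraproduct.mk (f i))) := by
        have h1 := MvPolynomial.comp_aeval_apply (R := ℤ) ![(Nat.card (V k) : ℤ), (d k : ℤ)]
          (Int.castRingHom ℝ).toIntAlgHom (p (t fun i => GraphUltraproduct.mk (f i)))
        have e2 : (fun i => (Int.castRingHom ℝ).toIntAlgHom
            (![(Nat.card (V k) : ℤ), (d k : ℤ)] i)) = ![(Nat.card (V k) : ℝ), (d k : ℝ)] := by
          funext i; fin_cases i <;> simp
        rw [e2] at h1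
        exact h1
      rw [e, Int.cast_natCast] at h'
      exact h'.symm
    choose θ hθ using exists_formula_of_distType.{u} (m := m) (N := N)
    have hθ' : ∀ (a : Fin m → GraphUltraproduct U H) τ, (θ τ).Realize a ↔ t a = τ := by
      intro a τ
      rw [hθ]
      refine ⟨fun h => ?_, ?_⟩
      · funext i j k
        exact propext (h i j k)
      · rintro rfl i j k
        exact Iff.rfl
    -- The classes are indexed by the attained values, not by types: different types may give the
    -- same cardinality, which would break the equivalence, and unattained values would give empty
    -- classes.
    have hfin : (Set.range fun a : Fin m → GraphUltraproduct U H => val (t a)).Finite :=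
      (Set.finite_range val).subset (Set.range_comp_subset_range t val)
    have := hfin.to_subtype
    obtain ⟨r, ⟨e⟩⟩ := Finite.exists_equiv_fin
      (Set.range fun a : Fin m → GraphUltraproduct U H => val (t a))
    choose w hw using fun i : Fin r => (e.symm i).2
    have hψ : ∀ (a : Fin m → GraphUltraproduct U H) (i : Fin r),
        (Formula.iSup fun τ : {τ // val τ = e.symm i} => θ τ).Realize a ↔
          val (t a) = e.symm i := by
      intro a i
      rw [Formula.realize_iSup]
      constructor
      · rintro ⟨⟨τ, hτ⟩, h⟩
        rw [(hθ' a τ).1 h, hτ]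
      · intro h
        exact ⟨⟨t a, h⟩, (hθ' a _).2 rfl⟩
    refine ⟨r, fun i => p (t (w i)), fun i => Formula.iSup fun τ : {τ // val τ = e.symm i} => θ τ,
      fun i => ⟨w i, (hψ _ _).2 (hw i)⟩, fun a => ?_, fun a i => ?_⟩
    · refine ⟨e ⟨val (t a), a, rfl⟩, (hψ _ _).2 (by rw [e.symm_apply_apply]), fun i hi => ?_⟩
      rw [← e.symm_apply_eq]
      exact Subtype.ext ((hψ a i).1 hi).symm
    · rw [hψ]
      have hwi : MvPolynomial.aeval ![α, β] (p (t (w i))) = (e.symm i : (U : Filter ℕ).Germ ℝ) :=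
        hw i
      rw [hwi]
      constructor
      -- Uniqueness of the nonstandard cardinality shows that a tuple with the `i`-th value lies in
      -- the `i`-th class.
      · exact fun h => (hcard a).unique h
      · exact fun h => h ▸ hcard a
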